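/- Let $k\ge 2$ be such that $T_k(x)=x^k+x+1$ is primitive over $\mathbb F_2$, i.e. $T_k$ is irreducible and the class of $x$ in $\mathbb F_2[x]/(T_k)$ has multiplicative order $2^k-1$. Let $F:\{0,1\}^k\to\{0,1\}^k$, $F(x_0,\dots,x_{k-1})=(x_1,\dots,x_{k-1},\,\sum_{i<k}c_ix_i \bmod 2)$, be the successor map of the linear-feedback shift register with characteristic polynomial $T_k=x^k+\sum_{i<k}c_ix^i$, and let $F'$ be the map obtained from $F$ by interchanging the successors of the two states $0^k$ and $10^{k-1}$ (cycle joining). Let $(s_t)_{t\ge0}$ be any binary sequence whose states $x_t=(s_t,\dots,s_{t+k-1})$ satisfy $x_{t+1}=F'(x_t)$ for all $t\ge 0$, and let $M_k$ be the cyclic word obtained from the cyclic word $s_0s_1\cdots s_{2^k-1}$ by reversing it and complementing every letter. Then $M_k$ has exactly one rotation $U$ (a linear word) that starts with $0^k$, and $U$ is a binary de Bruijn sequence of order $k$: it has length $2^k$ and every binary word of length $k$ occurs exactly once as a cyclic window of $U$. Let $U_{\mathrm{lin}}=U\,U[0..k-2]$ be $U$ followed by its first $k-1$ letters, and let $\$$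 be an end marker smaller than $0<1$. Let $\operatorname{BWT}(U_{\mathrm{lin}}\$)$ be the last column of the matrix whose rows are all cyclic rotations of $U_{\mathrm{lin}}\$$ in lexicographic order. Then $$\operatorname{BWT}(U_{\mathrm{lin}}\$)=0^{k-1}\,1\,\$\,(0011)^{2^{k-2}-1}\,010,$$ and the number of runs (maximal blocks of consecutive equal letters) of this string is $r=2^{k-1}+4$. -/

import Mathlib

open Polynomial

/-! ### Strings, Burrows-Wheeler transform, runs -/

/-- The letters of the binary alphabet are the elements of `𝔽₂`, ordered by `0 < 1`. -/
instance instLinearOrderBinaryAlphabet : LinearOrder (ZMod 2) :=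
  inferInstanceAs (LinearOrder (Fin 2))

/-- The terminated string `w$`. The terminator `$` is the bottom element `⊥` of `WithBot α`, so it
is not a letter of `α` and is smaller than every letter of `α`. -/
def terminate {α : Type*} (w : List α) : List (WithBot α) :=
  w.map (fun a => (a : WithBot α)) ++ [⊥]

/-- The rotation matrix of `w`: the list of the `|w|` cyclic rotations of `w` (its rows), sorted
lexicographically. -/
def rotationMatrix {α : Type*} [LinearOrder α] (w : List α) : List (List α) :=
  ((List.range w.length).map (fun i => w.rotate i)).mergeSort (fun x y => decide (x ≤ y))

/-- The Burrows-Wheeler transform of `w`: the last column of its rotation matrix. (The rows are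
never empty, so each of them contributes exactly one letter.) -/
def bwt {α : Type*} [LinearOrder α] (w : List α) : List α :=
  (rotationMatrix w).filterMap List.getLast?

/-- The number of runs (maximal blocks of consecutive equal letters) of a string. -/
def numRuns {α : Type*} [DecidableEq α] (w : List α) : ℕ :=
  (w.splitBy (fun a b => decide (a = b))).length

/-- The linearization `U U[0..k-2]`: the first `k - 1` letters of `U` are appended to `U`. -/
def linearize {α : Type*} (k : ℕ) (U : List α) : List α :=
  U ++ U.take (k - 1)

/-- `U` is (a rotation of) a binary de Bruijn sequence of order `k`: it has length `2 ^ k`, and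
every binary word of length `k` occurs exactly once as a cyclic window of `U`. -/
def IsDeBruijn (k : ℕ) (U : List (ZMod 2)) : Prop :=
  U.length = 2 ^ k ∧
    ∀ v : List (ZMod 2), v.length = k → ∃! i : ℕ, i < 2 ^ k ∧ (U.rotate i).take k = v

/-! ### Feedback shift registers and cycle joining -/

/-- `C` is primitive over `𝔽₂`: it is irreducible and the residue class of `X` modulo `C` has
multiplicative order `2 ^ deg C - 1`. -/
def IsPrimitiveBinary (C : (ZMod 2)[X]) : Prop :=
  Irreducible C ∧ orderOf (AdjoinRoot.root C) = 2 ^ C.natDegree - 1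

/-- The trinomial `T_k = x ^ k + x + 1` over `𝔽₂`. -/
noncomputable def lfsrTrinomial (k : ℕ) : (ZMod 2)[X] := X ^ k + X + 1

/-- The successor map `(x₀, …, x_{k-1}) ↦ (x₁, …, x_{k-1}, ∑ cᵢ xᵢ)` on the states of the
linear-feedback shift register of length `k` with characteristic polynomial
`C = x ^ k + c_{k-1} x ^ (k-1) + ⋯ + c₀`. -/
def lfsrSucc (C : (ZMod 2)[X]) (k : ℕ) (x : Fin k → ZMod 2) : Fin k → ZMod 2 :=
  fun i => if h : (i : ℕ) + 1 < k then x ⟨i + 1, h⟩ else ∑ j : Fin k, C.coeff j * x j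

/-- The successor map obtained from `F` by interchanging the successors of the states `u`, `v`. -/
def joinSucc {k : ℕ} (F : (Fin k → ZMod 2) → (Fin k → ZMod 2)) (u v : Fin k → ZMod 2) :
    (Fin k → ZMod 2) → (Fin k → ZMod 2) :=
  fun x => F (Equiv.swap u v x)

/-- The state `0 ^ k`. -/
def zeroState (k : ℕ) : Fin k → ZMod 2 := fun _ => 0

/-- The state `1 0 ^ (k-1)`. -/
def oneZeroState (k : ℕ) : Fin k → ZMod 2 := fun i => if (i : ℕ) = 0 then 1 else 0

/-- The state `(s_t, …, s_{t+k-1})` of a sequence `s` at time `t`. -/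
def stateAt (k : ℕ) (s : ℕ → ZMod 2) (t : ℕ) : Fin k → ZMod 2 := fun i => s (t + i)

/-- `s` is a sequence produced (from an arbitrary seed) by joining the main cycle and the `0`th
cycle of the shift register with characteristic polynomial `T_k = x ^ k + x + 1` along the
conjugate pair `(0 ^ k, 1 0 ^ (k-1))`. -/
def IsJoinedSequence (k : ℕ) (s : ℕ → ZMod 2) : Prop :=
  ∀ t, stateAt k s (t + 1) =
    joinSucc (lfsrSucc (lfsrTrinomial k) k) (zeroState k) (oneZeroState k) (stateAt k s t)

/-- The cyclic words `M_k`: take the cyclic word `s₀ s₁ ⋯ s_{2^k-1}` formed by one period of the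
joined sequence, reverse it, and complement every letter. -/
def runMinimalWords (k : ℕ) : Set (Cycle (ZMod 2)) :=
  {M | ∃ s : ℕ → ZMod 2, IsJoinedSequence k s ∧
    M = (((List.range (2 ^ k)).map s : List (ZMod 2)) : Cycle (ZMod 2)).reverse.map (fun a => a + 1)}

/-- The string `0^{k-1} 1 $ (0011)^{2^{k-2}-1} 010`. -/
def bwtPattern (k : ℕ) : List (WithBot (ZMod 2)) :=
  List.replicate (k - 1) 0 ++ [1, ⊥] ++
    (List.replicate (2 ^ (k - 2) - 1) [0, 0, 1, 1]).flatten ++ [0, 1, 0]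

/-! The register acts on states as multiplication by the root `α` of `T_k` acts on the field
`AdjoinRoot T_k`. Primitivity makes the powers of `α` exhaust the nonzero elements, so the nonzero
states form one cycle, and the swap inserts `0^k` into it. The joined sequence therefore has period
`2^k`, shows every state, and satisfies `s_{t+k} = s_t + s_{t+1}`, with an extra 1 exactly when
`s_{t+1}, …, s_{t+k-1}` all vanish.

Reversing and complementing turns this into `u_i = u_{i+k} + u_{i+k-1} + 1`, the 1 dropping out when
`u_{i+1}, …, u_{i+k-1}` are all 1. So the letter before a window depends only on the last two
letters of the window, up to that exception (`IsRunMinimalSequence`).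

The sorted rotations of `U_lin$` begin with `0^j $` for `j < k`, then with the words of length `k`
in lexicographic order (`bwt_eq_of_rotations`). The first group ends in `0^{k-1} 1`. For the second,
final pairs `00, 01, 10, 11` give `1001` repeated; replacing the first letter by `$` (before `0^k`)
and swapping the last two (windows starting with `1^{k-1}`) yields the pattern. -/

section Algebra

/-! ### The register in field terms, and cycle joining -/

theorem lfsrTrinomial_natDegree {k : ℕ} (hk : 2 ≤ k) : (lfsrTrinomial k).natDegree = k := by
  unfold lfsrTrinomial
  have h1 : 1 ≠ k := by omega
  have h0 : k ≠ 0 := by omega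
  compute_degree!
  · simp [h1, h0]
  · omega

theorem lfsrSucc_lfsrTrinomial_last {k : ℕ} (hk : 2 ≤ k) (x : Fin k → ZMod 2) (i : Fin k)
    (hi : (i : ℕ) + 1 = k) :
    lfsrSucc (lfsrTrinomial k) k x i = x ⟨0, by omega⟩ + x ⟨1, by omega⟩ := by
  obtain ⟨n, rfl⟩ : ∃ n, k = n + 2 := ⟨k - 2, by omega⟩
  have hc : ∀ j : ℕ, j < n + 2 → (lfsrTrinomial (n + 2)).coeff j =
      if j = 0 ∨ j = 1 then 1 else 0 := by
    intro j hj
    simp only [lfsrTrinomial, coeff_add, coeff_X_pow, coeff_X, coeff_one]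
    rcases j with _ | _ | j
    · simp
    · simp
    · have : j ≠ n := by omega
      simp [this]
  unfold lfsrSucc
  rw [dif_neg (by omega), Fin.sum_univ_succ, Fin.sum_univ_succ, Finset.sum_eq_zero]
  · rw [hc _ (Fin.is_lt _), hc _ (Fin.is_lt _)]
    simp
  · intro j _
    rw [hc _ (Fin.is_lt _)]
    simp

theorem lfsrSucc_zeroState (C : (ZMod 2)[X]) (k : ℕ) :
    lfsrSucc C k (zeroState k) = zeroState k := by
  funext i
  simp [lfsrSucc, zeroState]

/-- The shift register is conjugate to multiplication by the root of a primitive trinomial. -/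
theorem exists_conj_lfsrSucc {k : ℕ} (hk : 2 ≤ k) [Fact (Irreducible (lfsrTrinomial k))] :
    ∃ φ : AdjoinRoot (lfsrTrinomial k) → (Fin k → ZMod 2), Function.Bijective φ ∧
      φ 0 = zeroState k ∧
      ∀ z, lfsrSucc (lfsrTrinomial k) k (φ z) = φ (AdjoinRoot.root (lfsrTrinomial k) * z) := by
  have hirr : Irreducible (lfsrTrinomial k) := Fact.out
  set T := lfsrTrinomial k
  set α := AdjoinRoot.root T
  let pb := AdjoinRoot.powerBasis hirr.ne_zero
  have hdim : pb.dim = k := lfsrTrinomial_natDegree hk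
  have hgen : pb.gen = α := rfl
  obtain ⟨l, hl⟩ : ∃ l : Module.Dual (ZMod 2) (AdjoinRoot T), l 1 ≠ 0 := by
    by_contra! h
    exact one_ne_zero ((Module.forall_dual_apply_eq_zero_iff (ZMod 2) (1 : AdjoinRoot T)).1 h)
  -- The state of `z` lists `l (α ^ i * z)`, so multiplying by `α` shifts it. If all entries vanish,
  -- `l (· * z)` is zero on the power basis; evaluating at `z⁻¹` contradicts `l 1 ≠ 0`.
  let φ : AdjoinRoot T →ₗ[ZMod 2] (Fin k → ZMod 2) :=
    LinearMap.pi fun i => l ∘ₗ LinearMap.mulLeft (ZMod 2) (α ^ (i : ℕ))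
  have hφ : ∀ z i, φ z i = l (α ^ (i : ℕ) * z) := fun z i => rfl
  have hinj : Function.Injective φ := by
    rw [injective_iff_map_eq_zero]
    intro z hz
    by_contra hne
    have h0 : l ∘ₗ LinearMap.mulRight (ZMod 2) z = 0 := by
      refine pb.basis.ext fun i => ?_
      have := congrFun hz (Fin.cast hdim i)
      rw [hφ] at this
      simpa [hgen] using this
    apply hl
    simpa [hne] using LinearMap.congr_fun h0 z⁻¹
  have : Module.Finite (ZMod 2) (AdjoinRoot T) := pb.finite
  have hsurj : Function.Surjective φ := by
    refine (LinearMap.injective_iff_surjective_of_finrank_eq_finrank ?_).1 hinj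
    rw [pb.finrank, hdim]
    simp
  refine ⟨φ, ⟨hinj, hsurj⟩, ?_, ?_⟩
  · rw [map_zero]; rfl
  · intro z
    funext i
    by_cases hi : (i : ℕ) + 1 < k
    · simp only [lfsrSucc, dif_pos hi, hφ]
      ring_nf
    · rw [lfsrSucc_lfsrTrinomial_last hk _ i (by omega)]
      simp only [hφ]
      have hroot : α ^ k + α + 1 = 0 := by
        have : eval₂ (AdjoinRoot.of T) α (X ^ k + X + 1) = 0 := AdjoinRoot.eval₂_root T
        simpa using this
      have h2 : l (α ^ (i : ℕ) * (α * z)) + (l (α ^ 0 * z) + l (α ^ 1 * z)) = 0 := by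
        rw [← map_add, ← map_add]
        have : α ^ (i : ℕ) * (α * z) + (α ^ 0 * z + α ^ 1 * z) = (α ^ ((i : ℕ) + 1) + α + 1) * z := by
          ring
        rw [this, show (i : ℕ) + 1 = k by omega, hroot, zero_mul, map_zero]
      generalize l (α ^ (i : ℕ) * (α * z)) = a at h2 ⊢
      generalize l (α ^ 0 * z) + l (α ^ 1 * z) = b at h2 ⊢
      revert a b
      decide

/-- The orbits of the register on the nonzero states are full. -/
theorem lfsrSucc_orbit {k : ℕ} (hk : 2 ≤ k) (hT : IsPrimitiveBinary (lfsrTrinomial k))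
    (e : Fin k → ZMod 2) (he : e ≠ zeroState k) :
    (lfsrSucc (lfsrTrinomial k) k)^[2 ^ k - 1] e = e ∧
    (∀ j, (lfsrSucc (lfsrTrinomial k) k)^[j] e ≠ zeroState k) ∧
    (∀ j, 0 < j → j < 2 ^ k - 1 → (lfsrSucc (lfsrTrinomial k) k)^[j] e ≠ e) ∧
    ∀ x, x ≠ zeroState k → ∃ j < 2 ^ k - 1, (lfsrSucc (lfsrTrinomial k) k)^[j] e = x := by
  have : Fact (Irreducible (lfsrTrinomial k)) := ⟨hT.1⟩
  obtain ⟨φ, hφ, hφ0, hφm⟩ := exists_conj_lfsrSucc hk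
  have hord := hT.2
  rw [lfsrTrinomial_natDegree hk] at hord
  set F := lfsrSucc (lfsrTrinomial k) k
  set α := AdjoinRoot.root (lfsrTrinomial k)
  have hcard : Nat.card (AdjoinRoot (lfsrTrinomial k)) = 2 ^ k := by
    rw [Nat.card_eq_of_bijective φ hφ]
    simp
  have : Finite (AdjoinRoot (lfsrTrinomial k)) := Finite.of_injective φ hφ.1
  have := Fintype.ofFinite (AdjoinRoot (lfsrTrinomial k))
  classical
  obtain ⟨z, rfl⟩ := hφ.2 e
  have hz : z ≠ 0 := by rintro rfl; exact he hφ0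
  have hit : ∀ j, F^[j] (φ z) = φ (α ^ j * z) := by
    intro j
    induction j with
    | zero => simp
    | succ j ih => rw [Function.iterate_succ_apply', ih, hφm, pow_succ', mul_assoc]
  have hpos : 0 < 2 ^ k - 1 := by
    have : 2 ^ 1 < 2 ^ k := Nat.pow_lt_pow_right (by norm_num) (by omega)
    omega
  have hα0 : α ≠ 0 := by
    intro h
    have := pow_orderOf_eq_one α
    rw [hord, h, zero_pow hpos.ne'] at this
    exact zero_ne_one this
  have hpow : ∀ y : AdjoinRoot (lfsrTrinomial k), y ≠ 0 → ∃ j < 2 ^ k - 1, α ^ j = y := by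
    have hsub : (Finset.range (2 ^ k - 1)).image (α ^ ·) ⊆ Finset.univ.erase 0 := by
      intro y hy
      obtain ⟨j, -, rfl⟩ := Finset.mem_image.1 hy
      simp [hα0]
    have heq := Finset.eq_of_subset_of_card_le hsub (by
      rw [Finset.card_erase_of_mem (Finset.mem_univ _), Finset.card_univ, ← Nat.card_eq_fintype_card,
        hcard, Finset.card_image_of_injOn, Finset.card_range]
      rw [← hord, Finset.coe_range]
      exact pow_injOn_Iio_orderOf)
    intro y hy
    have : y ∈ Finset.univ.erase (0 : AdjoinRoot (lfsrTrinomial k)) := by simp [hy]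
    rw [← heq] at this
    obtain ⟨j, hj, h⟩ := Finset.mem_image.1 this
    exact ⟨j, Finset.mem_range.1 hj, h⟩
  refine ⟨?_, ?_, ?_, ?_⟩
  · rw [hit, ← hord, pow_orderOf_eq_one, one_mul]
  · intro j h
    rw [hit, ← hφ0] at h
    exact mul_ne_zero (pow_ne_zero _ hα0) hz (hφ.1 h)
  · intro j h0 hj h
    rw [hit] at h
    have h1 : α ^ j = 1 := by
      have := hφ.1 h
      exact mul_right_cancel₀ hz (this.trans (one_mul z).symm)
    exact pow_ne_one_of_lt_orderOf h0.ne' (hord ▸ hj) h1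
  · intro x hx
    obtain ⟨y, rfl⟩ := hφ.2 x
    have hy : y ≠ 0 := by rintro rfl; exact hx hφ0
    obtain ⟨j, hj, h⟩ := hpow (y * z⁻¹) (mul_ne_zero hy (inv_ne_zero hz))
    exact ⟨j, hj, by rw [hit, h, inv_mul_cancel_right₀ hz]⟩

/-- Joining the zero cycle to the cycle of the nonzero states gives a single cycle. -/
theorem joinSucc_orbit {k : ℕ} (hk : 2 ≤ k) (hT : IsPrimitiveBinary (lfsrTrinomial k)) :
    (joinSucc (lfsrSucc (lfsrTrinomial k) k) (zeroState k) (oneZeroState k))^[2 ^ k] (zeroState k) =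
      zeroState k ∧
    ∀ x, ∃ j,
      (joinSucc (lfsrSucc (lfsrTrinomial k) k) (zeroState k) (oneZeroState k))^[j] (zeroState k) =
        x := by
  have he : oneZeroState k ≠ zeroState k := by
    intro h
    have := congrFun h ⟨0, by omega⟩
    simp [oneZeroState, zeroState] at this
  obtain ⟨hper, hne0, hne, hall⟩ := lfsrSucc_orbit hk hT _ he
  have hF0 := lfsrSucc_zeroState (lfsrTrinomial k) k
  set F := lfsrSucc (lfsrTrinomial k) k
  set e := oneZeroState k
  set o := zeroState k
  have hpos : 2 ≤ 2 ^ k - 1 := by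
    have : 2 ^ 2 ≤ 2 ^ k := Nat.pow_le_pow_right (by norm_num) (by omega)
    omega
  -- The swap sends the zero state onto the orbit of `e`; after that the two maps agree until the
  -- orbit returns to `e`.
  have hit : ∀ j, j + 1 ≤ 2 ^ k - 1 → (joinSucc F o e)^[j + 1] o = F^[j + 1] e := by
    intro j
    induction j with
    | zero => intro _; simp [joinSucc]
    | succ j ih =>
      intro hj
      rw [Function.iterate_succ_apply', ih (by omega), Function.iterate_succ_apply' F (j + 1)]
      simp only [joinSucc]
      rw [Equiv.swap_apply_of_ne_of_ne (hne0 _) (hne _ (by omega) (by omega))]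
  have hlast : (joinSucc F o e)^[2 ^ k - 1] o = e := by
    have := hit (2 ^ k - 2) (by omega)
    rwa [show 2 ^ k - 2 + 1 = 2 ^ k - 1 by omega, hper] at this
  refine ⟨?_, ?_⟩
  · rw [show 2 ^ k = (2 ^ k - 1) + 1 by omega, Function.iterate_succ_apply', hlast]
    simp [joinSucc, hF0]
  · intro x
    by_cases hx : x = o
    · exact ⟨0, hx.symm⟩
    · obtain ⟨j, hj, h⟩ := hall x hx
      rcases j with _ | j
      · exact ⟨2 ^ k - 1, hlast.trans h⟩
      · exact ⟨j + 1, (hit j (by omega)).trans h⟩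

/-- All states lie on one cycle, so the seed only fixes a phase `a` on it. The swap alters the
feedback bit exactly at the two states whose entries after the first are zero. -/
theorem IsJoinedSequence.structure {k : ℕ} (hk : 2 ≤ k) (hT : IsPrimitiveBinary (lfsrTrinomial k))
    {s : ℕ → ZMod 2} (hs : IsJoinedSequence k s) :
    (∀ t, s (t + 2 ^ k) = s t) ∧ (∀ x, ∃ t, stateAt k s t = x) ∧
    (∀ t, (∀ j, 0 < j → j < k → s (t + j) = 0) → s (t + k) = s t + s (t + 1) + 1) ∧
    ∀ t, ¬ (∀ j, 0 < j → j < k → s (t + j) = 0) → s (t + k) = s t + s (t + 1) := by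
  obtain ⟨hper, hall⟩ := joinSucc_orbit hk hT
  obtain ⟨a, ha⟩ := hall (stateAt k s 0)
  have hst : ∀ t, stateAt k s t =
      (joinSucc (lfsrSucc (lfsrTrinomial k) k) (zeroState k) (oneZeroState k))^[t + a]
        (zeroState k) := by
    intro t
    induction t with
    | zero => rw [zero_add, ha]
    | succ t ih => rw [hs, ih, ← Function.iterate_succ_apply' (joinSucc _ _ _), Nat.succ_add_eq_add_succ]; rfl
  have hper' : ∀ n, (joinSucc (lfsrSucc (lfsrTrinomial k) k) (zeroState k)
      (oneZeroState k))^[2 ^ k * n] (zeroState k) = zeroState k := fun n =>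
    (show Function.IsPeriodicPt _ (2 ^ k) _ from hper).mul_const n
  have hnext : ∀ t, s (t + k) =
      Equiv.swap (zeroState k) (oneZeroState k) (stateAt k s t) ⟨0, by omega⟩ +
      Equiv.swap (zeroState k) (oneZeroState k) (stateAt k s t) ⟨1, by omega⟩ := by
    intro t
    have h := congrFun (hs t) ⟨k - 1, by omega⟩
    simp only [stateAt, joinSucc] at h
    rw [show t + 1 + (k - 1) = t + k by omega,
      lfsrSucc_lfsrTrinomial_last hk _ _ (by simp; omega)] at h
    exact h
  refine ⟨?_, ?_, ?_, ?_⟩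
  · intro t
    have : stateAt k s (t + 2 ^ k) = stateAt k s t := by
      rw [hst, hst, show t + 2 ^ k + a = t + a + 2 ^ k by omega, Function.iterate_add_apply, hper]
    have := congrFun this ⟨0, by omega⟩
    simpa [stateAt] using this
  · intro x
    obtain ⟨b, hb⟩ := hall x
    -- This time is `b - a` modulo the period `2 ^ k`, written without subtraction.
    refine ⟨b + (2 ^ k - 1) * a, ?_⟩
    have h1 : b + (2 ^ k - 1) * a + a = b + 2 ^ k * a := by
      have : 0 < 2 ^ k := by positivity
      obtain ⟨n, hn⟩ : ∃ n, 2 ^ k = n + 1 := ⟨2 ^ k - 1, by omega⟩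
      rw [hn]; simp; ring
    rw [hst, h1, Function.iterate_add_apply, hper', hb]
  · intro t hc
    have key : ∀ b : ZMod 2, s t = b →
        stateAt k s t = if b = 0 then zeroState k else oneZeroState k := by
      intro b hb
      funext i
      by_cases hi : (i : ℕ) = 0
      · have hb1 : ∀ b : ZMod 2, b = 0 ∨ b = 1 := by decide
        rcases hb1 b with rfl | rfl <;> simp [stateAt, zeroState, oneZeroState, hi, hb]
      · have := hc i (by omega) i.2
        split_ifs <;> simp [stateAt, zeroState, oneZeroState, hi, this]
    have h1 : s (t + 1) = 0 := hc 1 (by omega) (by omega)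
    have hb1 : ∀ b : ZMod 2, b = 0 ∨ b = 1 := by decide
    rw [hnext]
    rcases hb1 (s t) with h0 | h0
    · rw [key 0 h0, h0, h1]; simp [oneZeroState]
    · rw [key 1 h0, h0, h1]; simp [zeroState]; rfl
  · intro t hc
    rw [hnext, Equiv.swap_apply_of_ne_of_ne]
    · simp [stateAt]
    · intro hz
      refine hc fun j _ hj => ?_
      exact congrFun hz ⟨j, hj⟩
    · intro hz
      refine hc fun j h0 hj => ?_
      have := congrFun hz ⟨j, hj⟩
      simpa [stateAt, oneZeroState, h0.ne'] using this

end Algebra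

/-! ### Binary words in order and their preceding letters -/

section Words

/-- The binary words of length `n`, in lexicographic order. -/
def binaryWords : ℕ → List (List (ZMod 2))
  | 0 => [[]]
  | n + 1 => (binaryWords n).map (List.cons 0) ++ (binaryWords n).map (List.cons 1)

theorem ZMod.eq_zero_or_one (a : ZMod 2) : a = 0 ∨ a = 1 := by
  revert a; decide

theorem ZMod.zero_lt_one_two : (0 : ZMod 2) < 1 := by decide

theorem mem_binaryWords {n : ℕ} {w : List (ZMod 2)} : w ∈ binaryWords n ↔ w.length = n := by
  induction n generalizing w with
  | zero => simp [binaryWords]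
  | succ n ih =>
    cases w with
    | nil => simp [binaryWords]
    | cons a w =>
      rcases ZMod.eq_zero_or_one a with rfl | rfl <;> simp [binaryWords, ih]

theorem length_binaryWords (n : ℕ) : (binaryWords n).length = 2 ^ n := by
  induction n with
  | zero => rfl
  | succ n ih => simp [binaryWords, ih, pow_succ, mul_two]

theorem pairwise_binaryWords (n : ℕ) : (binaryWords n).Pairwise (· < ·) := by
  induction n with
  | zero => simp [binaryWords]
  | succ n ih =>
    simp only [binaryWords, List.pairwise_append, List.pairwise_map, List.cons_lt_cons_iff,
      List.mem_map, lt_irrefl, false_or, true_and]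
    refine ⟨ih, ih, ?_⟩
    rintro _ ⟨a, -, rfl⟩ _ ⟨b, -, rfl⟩
    exact List.cons_lt_cons_iff.2 (Or.inl ZMod.zero_lt_one_two)

theorem binaryWords_succ_eq_flatMap (n : ℕ) :
    binaryWords (n + 1) = (binaryWords n).flatMap fun w => [w ++ [0], w ++ [1]] := by
  induction n with
  | zero => rfl
  | succ n ih =>
    conv_lhs => rw [binaryWords, ih]
    conv_rhs => rw [binaryWords]
    simp [List.flatMap_append, List.map_flatMap, List.flatMap_map]

theorem exists_binaryWords_eq (n : ℕ) :
    ∃ l, binaryWords (n + 2) = List.replicate (n + 2) 0 :: l ++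
      [List.replicate (n + 1) 1 ++ [0], List.replicate (n + 2) 1] := by
  induction n with
  | zero => exact ⟨[[0, 1]], rfl⟩
  | succ n ih =>
    obtain ⟨l, hl⟩ := ih
    rw [binaryWords, hl]
    exact ⟨l.map (List.cons 0) ++ [0 :: (List.replicate (n + 1) 1 ++ [0]),
      0 :: List.replicate (n + 2) 1] ++ (1 :: List.replicate (n + 2) 0) :: l.map (List.cons 1), by
        simp [List.replicate_succ]⟩

theorem flatten_replicate_rotate {α : Type*} (a b c d : α) (q : ℕ) :
    (List.replicate (q + 1) [a, b, c, d]).flatten =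
      a :: (List.replicate q [b, c, d, a]).flatten ++ [b, c, d] := by
  induction q with
  | zero => rfl
  | succ q ih => rw [List.replicate_succ, List.flatten_cons, ih]; simp [List.replicate_succ]

/-- The letter that precedes the window `v` in a terminated linearized run-minimal word. -/
def precedingLetter (k : ℕ) (v : List (ZMod 2)) : WithBot (ZMod 2) :=
  if v = List.replicate k 0 then ⊥
  else if v.take (k - 1) = List.replicate (k - 1) 1 then
    ((v.getD (k - 1) 0 + v.getD (k - 2) 0 : ZMod 2) : WithBot (ZMod 2))
  else ((v.getD (k - 1) 0 + v.getD (k - 2) 0 + 1 : ZMod 2) : WithBot (ZMod 2))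

theorem map_precedingLetter_binaryWords {k : ℕ} (hk : 2 ≤ k) :
    (binaryWords k).map (precedingLetter k) =
      ⊥ :: (List.replicate (2 ^ (k - 2) - 1) [0, 0, 1, 1]).flatten ++ [0, 1, 0] := by
  obtain ⟨n, rfl⟩ : ∃ n, k = n + 2 := ⟨k - 2, by omega⟩
  obtain ⟨l, hl⟩ := exists_binaryWords_eq n
  let h : List (ZMod 2) → WithBot (ZMod 2) := fun v =>
    ((v.getD (n + 1) 0 + v.getD n 0 + 1 : ZMod 2) : WithBot (ZMod 2))
  -- Without the exceptions, each prefix of length `n` contributes one block `1001`, from its four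
  -- two-letter extensions.
  have h1 : (binaryWords (n + 2)).map h = (List.replicate (2 ^ n) [1, 0, 0, 1]).flatten := by
    rw [binaryWords_succ_eq_flatMap, binaryWords_succ_eq_flatMap, ← length_binaryWords n,
      ← List.map_const', ← List.flatMap_def, List.flatMap_assoc, List.map_flatMap]
    refine List.flatMap_congr fun w hw => ?_
    have hw := mem_binaryWords.1 hw
    have hg : ∀ a b : ZMod 2, h (w ++ [a, b]) = ((b + a + 1 : ZMod 2) : WithBot (ZMod 2)) := by
      intro a b
      simp [h, List.getD, hw]
    simp [hg]
    decide
  obtain ⟨q, hq⟩ : ∃ q, 2 ^ n = q + 1 := ⟨2 ^ n - 1, by have := Nat.two_pow_pos n; omega⟩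
  have hnd : (binaryWords (n + 2)).Nodup := (pairwise_binaryWords _).imp ne_of_lt
  have hmid : l.map (precedingLetter (n + 2)) = l.map h := by
    refine List.map_congr_left fun v hv => ?_
    have hlen : v.length = n + 2 := mem_binaryWords.1 (hl ▸ by simp [hv])
    rw [hl] at hnd
    have hv0 : v ≠ List.replicate (n + 2) 0 := by
      rintro rfl
      simp [hv] at hnd
    have hv1 : v.take (n + 1) ≠ List.replicate (n + 1) 1 := by
      intro hv'
      obtain ⟨a, ha⟩ : ∃ a, v.drop (n + 1) = [a] := List.length_eq_one_iff.1 (by simp [hlen])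
      have hva : v = List.replicate (n + 1) 1 ++ [a] := by
        rw [← hv', ← ha, List.take_append_drop]
      have hdis := (List.nodup_append.1 hnd).2.2 v (by simp [hv])
      rcases ZMod.eq_zero_or_one a with rfl | rfl
      · exact hdis _ (by simp) hva
      · exact hdis (List.replicate (n + 2) 1) (by simp) (by rw [hva, ← List.replicate_succ'])
    simp only [precedingLetter, if_neg hv0, Nat.add_sub_cancel]
    rw [show n + 2 - 1 = n + 1 by omega, if_neg hv1]
  have e0 : precedingLetter (n + 2) (List.replicate (n + 2) 0) = ⊥ := by simp [precedingLetter]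
  have e1 : precedingLetter (n + 2) (List.replicate (n + 1) 1 ++ [0]) = 1 := by
    have : List.replicate (n + 1) (1 : ZMod 2) ++ [0] ≠ List.replicate (n + 2) 0 := by
      simp [List.replicate_succ]
    simp [precedingLetter, this, List.getD]
  have e2 : precedingLetter (n + 2) (List.replicate (n + 2) 1) = 0 := by
    have hne : List.replicate (n + 2) (1 : ZMod 2) ≠ List.replicate (n + 2) 0 := by
      simp [List.replicate_succ]
    have ht : (List.replicate (n + 2) (1 : ZMod 2)).take (n + 1) = List.replicate (n + 1) 1 := by
      simp [List.take_replicate]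
    have hgd : ∀ i < n + 2, (List.replicate (n + 2) (1 : ZMod 2)).getD i 0 = 1 := by
      intro i hi
      simp [List.getD, hi]
    rw [precedingLetter, if_neg hne, show n + 2 - 1 = n + 1 by omega, if_pos ht,
      hgd _ (by omega), hgd _ (by omega)]
    rfl
  have f0 : h (List.replicate (n + 2) 0) = 1 := by simp [h, List.getD]
  rw [hl, hq, flatten_replicate_rotate] at h1
  rw [hl, show n + 2 - 2 = n by omega, hq, Nat.add_sub_cancel]
  simp only [List.cons_append, List.map_cons, List.map_append, e0, e1, e2, hmid] at h1 ⊢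
  have h2 := (List.cons.inj h1).2
  have h3 : l.map h ++ [h (List.replicate (n + 1) 1 ++ [0]), h (List.replicate (n + 2) 1)] =
    ((List.replicate q [0, 0, 1, 1]).flatten ++ [0]) ++ [0, 1] := by simpa using h2
  -- Only the first and the last two words are exceptional, so cutting those entries off the regular
  -- list determines the middle.
  rw [List.append_inj_left' h3 rfl]
  simp

end Words

/-! ### Sorting the rotations -/

section Rotations

theorem terminate_eq {α : Type*} (w : List α) : terminate w = w.map WithBot.some ++ [⊥] := by
  simp [terminate, List.map_eq_flatMap]

/-- A strictly increasing list of `|w|` rotations of `w` is its rotation matrix. -/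
theorem rotationMatrix_eq_of_pairwise {α : Type*} [LinearOrder α] {w : List α} {R : List (List α)}
    (hlen : R.length = w.length) (hrot : ∀ r ∈ R, r ~r w) (hR : R.Pairwise (· < ·)) :
    rotationMatrix w = R := by
  have hperm : R.Perm ((List.range w.length).map fun i => w.rotate i) := by
    -- Strict increase excludes repetitions, so inclusion and equal length already give a
    -- permutation.
    refine (List.subperm_of_subset (hR.imp ne_of_lt) fun r hr => ?_).perm_of_length_le
      (by simp [hlen])
    obtain ⟨n, hn⟩ := (hrot r hr).symm
    have hpos : 0 < w.length := hlen ▸ List.length_pos_of_mem hr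
    exact List.mem_map.2 ⟨n % w.length, List.mem_range.2 (Nat.mod_lt _ hpos), by
      rw [List.rotate_mod, hn]⟩
  refine List.Perm.eq_of_pairwise' (r := (· ≤ ·)) (List.pairwise_mergeSort' _ _)
    (hR.imp le_of_lt) ((List.mergeSort_perm _ _).trans hperm.symm)

theorem map_coe_append_lt {α : Type*} [LinearOrder α] {a b : List α} (hlen : a.length = b.length)
    (h : a < b) (x y : List (WithBot α)) :
    a.map WithBot.some ++ x < b.map WithBot.some ++ y := by
  induction a generalizing b with
  | nil =>
    cases b with
    | nil => exact absurd h (lt_irrefl _)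
    | cons => simp at hlen
  | cons c a ih =>
    cases b with
    | nil => simp at hlen
    | cons d b =>
      simp only [List.map_cons, List.cons_append]
      rw [List.cons_lt_cons_iff] at h ⊢
      rcases h with h | ⟨rfl, h⟩
      · exact Or.inl (WithBot.coe_lt_coe.2 h)
      · exact Or.inr ⟨rfl, ih (by simpa using hlen) h⟩

theorem replicate_zero_append_bot_lt {j : ℕ} {v : List (ZMod 2)} (h : j < v.length)
    (x y : List (WithBot (ZMod 2))) :
    List.replicate j (0 : WithBot (ZMod 2)) ++ ⊥ :: x < v.map WithBot.some ++ y := by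
  induction j generalizing v with
  | zero =>
    cases v with
    | nil => simp at h
    | cons a v => exact List.cons_lt_cons_iff.2 (Or.inl (WithBot.bot_lt_coe a))
  | succ j ih =>
    cases v with
    | nil => simp at h
    | cons a v =>
      simp only [List.replicate_succ, List.map_cons, List.cons_append]
      rw [List.cons_lt_cons_iff]
      rcases ZMod.eq_zero_or_one a with rfl | rfl
      · exact Or.inr ⟨rfl, ih (by simpa using h)⟩
      · exact Or.inl (WithBot.coe_lt_coe.2 ZMod.zero_lt_one_two)

/-- The transform of a word of length `2 ^ k + k` that has a rotation `0 ^ j ⊥ ⋯` for every `j < k`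
and a rotation starting with `v` for every binary word `v` of length `k`. -/
theorem bwt_eq_of_rotations {k : ℕ} {w : List (WithBot (ZMod 2))} (hw : w.length = 2 ^ k + k)
    (f : ℕ → WithBot (ZMod 2)) (g : List (ZMod 2) → WithBot (ZMod 2))
    (hf : ∀ j < k, ∃ x, (List.replicate j (0 : WithBot (ZMod 2)) ++ ⊥ :: x) ~r w ∧
      (List.replicate j (0 : WithBot (ZMod 2)) ++ ⊥ :: x).getLast? = some (f j))
    (hg : ∀ v : List (ZMod 2), v.length = k → ∃ y,
      (v.map WithBot.some ++ y) ~r w ∧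
      (v.map WithBot.some ++ y).getLast? = some (g v)) :
    bwt w = (List.range k).map f ++ (binaryWords k).map g := by
  choose! x hx hxl using hf
  choose! y hy hyl using hg
  have hR : rotationMatrix w = (List.range k).map (fun j => List.replicate j (0 : WithBot (ZMod 2)) ++ ⊥ :: x j) ++
      (binaryWords k).map (fun v => v.map WithBot.some ++ y v) := by
    refine rotationMatrix_eq_of_pairwise ?_ ?_ ?_
    · simp [hw, length_binaryWords, add_comm]
    · intro r hr
      rcases List.mem_append.1 hr with hr | hr
      · obtain ⟨j, hj, rfl⟩ := List.mem_map.1 hr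
        exact hx j (List.mem_range.1 hj)
      · obtain ⟨v, hv, rfl⟩ := List.mem_map.1 hr
        exact hy v (mem_binaryWords.1 hv)
    · rw [List.pairwise_append, List.pairwise_map, List.pairwise_map]
      refine ⟨?_, ?_, ?_⟩
      · refine List.pairwise_lt_range.imp fun {i j} hij => ?_
        have := replicate_zero_append_bot_lt (v := List.replicate j 0) (by simpa using hij) (x i)
          (⊥ :: x j)
        simpa using this
      · refine (pairwise_binaryWords k).imp_of_mem fun {a b} ha hb hab => ?_
        exact map_coe_append_lt ((mem_binaryWords.1 ha).trans (mem_binaryWords.1 hb).symm) hab _ _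
      · intro a ha b hb
        obtain ⟨j, hj, rfl⟩ := List.mem_map.1 ha
        obtain ⟨v, hv, rfl⟩ := List.mem_map.1 hb
        exact replicate_zero_append_bot_lt
          ((List.mem_range.1 hj).trans_eq (mem_binaryWords.1 hv).symm) _ _
  rw [bwt, hR, List.filterMap_append, List.filterMap_map, List.filterMap_map]
  congr 1
  · exact (List.filterMap_congr (g := fun j => some (f j))
      fun j hj => hxl j (List.mem_range.1 hj)).trans (congrFun List.filterMap_eq_map _)
  · exact (List.filterMap_congr (g := fun v => some (g v))
      fun v hv => hyl v (mem_binaryWords.1 hv)).trans (congrFun List.filterMap_eq_map _)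

end Rotations

/-! ### Counting runs -/

section Runs

theorem length_splitBy_loop {α : Type*} (r : α → α → Bool) (l : List α) (a : α) (g : List α)
    (gs : List (List α)) :
    (List.splitBy.loop r l a g gs).length = gs.length + (List.splitBy.loop r l a [] []).length := by
  induction l generalizing a g gs with
  | nil => simp [List.splitBy.loop]
  | cons b l ih =>
    simp only [List.splitBy.loop]
    split
    · rw [ih, ih b [a]]; simp
    · rw [ih, ih b [] [_]]; simp; omega

theorem numRuns_cons_cons {α : Type*} [DecidableEq α] (a b : α) (l : List α) :
    numRuns (a :: b :: l) = numRuns (b :: l) + if a = b then 0 else 1 := by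
  simp only [numRuns, List.splitBy, List.splitBy.loop]
  by_cases h : a = b
  · simp only [h, decide_true, if_true]
    rw [length_splitBy_loop]; simp
  · simp only [h, decide_false, if_false]
    rw [length_splitBy_loop]; simp; omega

theorem numRuns_replicate_append {α : Type*} [DecidableEq α] (n : ℕ) (a : α) (l : List α) :
    numRuns (List.replicate (n + 1) a ++ l) = numRuns (a :: l) := by
  induction n with
  | zero => rfl
  | succ n ih =>
    rw [← ih, List.replicate_succ, List.replicate_succ]
    simp [numRuns_cons_cons]

/-- Each block adds two runs; the trailing `a` keeps the last block from merging with what follows.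
-/
theorem numRuns_flatten_replicate {α : Type*} [DecidableEq α] {a b : α} (hab : a ≠ b) (n : ℕ)
    (l : List α) :
    numRuns ((List.replicate n [a, a, b, b]).flatten ++ a :: l) = 2 * n + numRuns (a :: l) := by
  induction n with
  | zero => simp
  | succ n ih =>
    rw [List.replicate_succ, List.flatten_cons]
    cases n with
    | zero => simp [numRuns_cons_cons, hab, hab.symm]; omega
    | succ n =>
      rw [List.replicate_succ, List.flatten_cons] at ih ⊢
      simp [numRuns_cons_cons, hab, hab.symm] at ih ⊢
      omega

theorem numRuns_bwtPattern {k : ℕ} (hk : 2 ≤ k) : numRuns (bwtPattern k) = 2 ^ (k - 1) + 4 := by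
  obtain ⟨n, rfl⟩ : ∃ n, k = n + 2 := ⟨k - 2, by omega⟩
  have h01 : (0 : WithBot (ZMod 2)) ≠ 1 := by decide
  have hb0 : (⊥ : WithBot (ZMod 2)) ≠ 0 := WithBot.bot_ne_coe
  have hb1 : (1 : WithBot (ZMod 2)) ≠ ⊥ := WithBot.coe_ne_bot
  obtain ⟨q, hq⟩ : ∃ q, 2 ^ n = q + 1 := ⟨2 ^ n - 1, by have := Nat.two_pow_pos n; omega⟩
  have hfl := numRuns_flatten_replicate h01 q [1, 0]
  rw [bwtPattern, show n + 2 - 1 = n + 1 by omega, show n + 2 - 2 = n by omega, List.append_assoc,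
    List.append_assoc, numRuns_replicate_append, pow_succ, hq, Nat.add_sub_cancel]
  have h10 : numRuns [(0 : WithBot (ZMod 2)), 1, 0] = 3 := by
    simp [numRuns_cons_cons, h01, h01.symm]; rfl
  rw [h10] at hfl
  simp only [List.cons_append, List.nil_append, numRuns_cons_cons, h01, hb1, if_false]
  have : numRuns (⊥ :: ((List.replicate q [(0 : WithBot (ZMod 2)), 0, 1, 1]).flatten ++ [0, 1, 0]))
      = numRuns ((List.replicate q [(0 : WithBot (ZMod 2)), 0, 1, 1]).flatten ++ [0, 1, 0]) + 1 := by
    cases q with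
    | zero => simp [numRuns_cons_cons, hb0]
    | succ q =>
      rw [List.replicate_succ, List.flatten_cons]
      simp [numRuns_cons_cons, hb0]
  rw [this, hfl]
  omega

end Runs

/-! ### Windows of the reversed complement, and the transform -/

section Windows

/-- The properties of the sequences obtained by reversing and complementing a joined sequence:
`2 ^ k` is a period, all words of length `k` are windows, and the reversed recurrence holds. -/
structure IsRunMinimalSequence (k : ℕ) (u : ℕ → ZMod 2) : Prop where
  periodic : ∀ i, u (i + 2 ^ k) = u i
  exists_window : ∀ v : List (ZMod 2), v.length = k →
    ∃ i, (List.range k).map (fun j => u (i + j)) = v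
  eq_of_ones : ∀ i, (∀ j, 0 < j → j < k → u (i + j) = 1) → u i = u (i + k) + u (i + (k - 1))
  eq_of_not_ones : ∀ i, ¬ (∀ j, 0 < j → j < k → u (i + j) = 1) →
    u i = u (i + k) + u (i + (k - 1)) + 1

/-- The factor `2 ^ k - 1` is `-1` modulo the period, so the index runs backwards while staying in
`ℕ`. -/
theorem isRunMinimalSequence_of_isJoinedSequence {k : ℕ} (hk : 2 ≤ k)
    (hT : IsPrimitiveBinary (lfsrTrinomial k)) {s : ℕ → ZMod 2} (hs : IsJoinedSequence k s) (c : ℕ) :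
    IsRunMinimalSequence k fun i => s (c + (2 ^ k - 1) * i) + 1 := by
  obtain ⟨hper, hsurj, hrec1, hrec0⟩ := hs.structure hk hT
  obtain ⟨n, hn⟩ : ∃ n, 2 ^ k = n + 1 := ⟨2 ^ k - 1, by have := Nat.two_pow_pos k; omega⟩
  rw [hn] at hper
  have hmul : ∀ x a, s (a + (n + 1) * x) = s a := by
    intro x
    induction x with
    | zero => simp
    | succ x ih => intro a; rw [mul_add, mul_one, ← add_assoc, hper, ih]
  have hcongr : ∀ {a b : ℕ} (x y : ℕ), a + (n + 1) * x = b + (n + 1) * y → s a = s b := by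
    intro a b x y h
    rw [← hmul x a, h, hmul]
  have hrel : ∀ i j d, j + d = k →
      s (c + n * (i + d)) = s (c + n * (i + k) + j) := by
    intro i j d h
    subst h
    exact hcongr j 0 (by ring)
  have hones : ∀ i, (∀ j, 0 < j → j < k → s (c + n * (i + j)) + 1 = 1) ↔
      ∀ j, 0 < j → j < k → s (c + n * (i + k) + j) = 0 := by
    intro i
    constructor
    · intro h j h0 hj
      rw [← hrel i j (k - j) (by omega)]
      simpa using h (k - j) (by omega) (by omega)
    · intro h j h0 hj
      rw [hrel i (k - j) j (by omega), h _ (by omega) (by omega), zero_add]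
  have hadd : ∀ a b : ZMod 2, a + b + 1 + 1 = a + 1 + (b + 1) := by decide
  have hadd' : ∀ a b : ZMod 2, a + b + 1 = a + 1 + (b + 1) + 1 := by decide
  simp only [hn, Nat.add_sub_cancel]
  refine ⟨?_, ?_, ?_, ?_⟩
  · intro i
    rw [hn]
    congr 1
    exact hcongr 0 n (by ring)
  · intro v hv
    obtain ⟨t, ht⟩ := hsurj fun i => v[k - 1 - (i : ℕ)] + 1
    -- Modulo `n + 1` this is `c - (k - 1 + t)`, so letter `j` of the window reads `s` at `t + (k -
    -- 1 - j)`.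
    refine ⟨c + n * (k - 1 + t), List.ext_getElem (by simp [hv]) fun j h1 h2 => ?_⟩
    have hj : j < k := by simpa using h1
    have h := congrFun ht ⟨k - 1 - j, by omega⟩
    simp only [stateAt, show k - 1 - (k - 1 - j) = j by omega] at h
    have h3 : s (c + n * (c + n * (k - 1 + t) + j)) = s (t + (k - 1 - j)) := by
      obtain ⟨B, hB⟩ : ∃ B, t + (k - 1 - j) = B := ⟨_, rfl⟩
      rw [hB, show k - 1 + t = B + j by omega]
      exact hcongr B (c + n * B + n * j) (by ring)
    rw [List.getElem_map, List.getElem_range, h3, h]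
    generalize v[j] = a
    revert a
    decide
  · intro i hi
    have h := hrec1 _ ((hones i).1 hi)
    rw [hrel i 1 (k - 1) (by omega), ← hadd, ← h]
    congr 1
    simpa using hrel i k 0 (by omega)
  · intro i hi
    have h := hrec0 _ (mt (hones i).2 hi)
    rw [hrel i 1 (k - 1) (by omega), ← hadd', ← h]
    congr 1
    simpa using hrel i k 0 (by omega)

theorem exists_isRunMinimalSequence {k : ℕ} (hk : 2 ≤ k)
    (hT : IsPrimitiveBinary (lfsrTrinomial k)) {M : Cycle (ZMod 2)} (hM : M ∈ runMinimalWords k)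
    {U : List (ZMod 2)} (hU : (U : Cycle (ZMod 2)) = M) :
    ∃ u, IsRunMinimalSequence k u ∧ U = (List.range (2 ^ k)).map u := by
  obtain ⟨s, hs, rfl⟩ := hM
  rw [Cycle.reverse_coe, Cycle.map_coe, Cycle.coe_eq_coe] at hU
  obtain ⟨r, rfl⟩ := hU.symm
  -- The offset is `-1 - r` modulo `2 ^ k`: reversal starts at the last letter, and the rotation
  -- moves `r` further back.
  refine ⟨_, isRunMinimalSequence_of_isJoinedSequence hk hT hs ((2 ^ k - 1) + (2 ^ k - 1) * r), ?_⟩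
  have hper := (hs.structure hk hT).1
  obtain ⟨n, hn⟩ : ∃ n, 2 ^ k = n + 1 := ⟨2 ^ k - 1, by have := Nat.two_pow_pos k; omega⟩
  rw [hn] at hper ⊢
  have hmul : ∀ x a, s (a + (n + 1) * x) = s a := by
    intro x
    induction x with
    | zero => simp
    | succ x ih => intro a; rw [mul_add, mul_one, ← add_assoc, hper, ih]
  refine List.ext_getElem (by simp) fun i h1 h2 => ?_
  rw [List.getElem_rotate]
  simp only [List.getElem_map, List.getElem_reverse, List.getElem_range, List.length_map,
    List.length_reverse, List.length_range, Nat.add_sub_cancel]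
  congr 1
  have hd := Nat.div_add_mod (i + r) (n + 1)
  have hlt := Nat.mod_lt (i + r) (Nat.succ_pos n)
  set m := (i + r) % (n + 1)
  set d := (i + r) / (n + 1)
  obtain ⟨p, hp⟩ : ∃ p, n = m + p := ⟨n - m, by omega⟩
  rw [show n - m = p by omega, ← hmul (m + n * d) p]
  congr 1
  have : n + n * r + n * i = n + n * ((n + 1) * d + m) := by rw [hd]; ring
  rw [this]
  nth_rewrite 3 [hp]
  ring

variable {k : ℕ} {u : ℕ → ZMod 2}

theorem IsRunMinimalSequence.take_rotate (hu : IsRunMinimalSequence k u) (i : ℕ) :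
    (((List.range (2 ^ k)).map u).rotate i).take k = (List.range k).map fun j => u (i + j) := by
  have hk := Nat.lt_two_pow_self (n := k)
  refine List.ext_getElem (by simp; omega) fun j h1 h2 => ?_
  rw [List.getElem_take, List.getElem_rotate]
  simp only [List.getElem_map, List.getElem_range, List.length_map, List.length_range]
  rw [(show Function.Periodic u (2 ^ k) from hu.periodic).map_mod_nat, add_comm]

theorem IsRunMinimalSequence.isDeBruijn (hu : IsRunMinimalSequence k u) :
    IsDeBruijn k ((List.range (2 ^ k)).map u) := by
  refine ⟨by simp, ?_⟩
  let f : Fin (2 ^ k) → List.Vector (ZMod 2) k := fun i =>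
    ⟨(List.range k).map fun j => u (i + j), by simp⟩
  have hf : Function.Bijective f := by
    rw [Fintype.bijective_iff_surjective_and_card]
    -- There are `2 ^ k` positions and as many words, so occurring at all implies occurring once.
    refine ⟨?_, by simp [card_vector]⟩
    rintro ⟨v, hv⟩
    obtain ⟨i, hi⟩ := hu.exists_window v hv
    refine ⟨⟨i % 2 ^ k, Nat.mod_lt _ (Nat.two_pow_pos k)⟩, Subtype.ext ?_⟩
    refine (List.map_congr_left fun j _ => ?_).trans hi
    have hp : Function.Periodic u (2 ^ k) := hu.periodic
    change u (i % 2 ^ k + j) = u (i + j)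
    rw [← hp.map_mod_nat, Nat.mod_add_mod, hp.map_mod_nat]
  intro v hv
  obtain ⟨i, hi, huniq⟩ := hf.existsUnique ⟨v, hv⟩
  refine ⟨i, ⟨i.2, ?_⟩, ?_⟩
  · rw [hu.take_rotate]; exact congrArg Subtype.val hi
  · rintro j ⟨hj, hjv⟩
    rw [hu.take_rotate] at hjv
    exact congrArg Fin.val (huniq ⟨j, hj⟩ (Subtype.ext hjv))

/-- The letter before a window, with `$` put before the window `0 ^ k`. -/
theorem IsRunMinimalSequence.precedingLetter_window (hu : IsRunMinimalSequence k u) (hk : 2 ≤ k)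
    (i : ℕ) (hne : (List.range k).map (fun j => u (i + 1 + j)) ≠ List.replicate k 0) :
    precedingLetter k ((List.range k).map fun j => u (i + 1 + j)) = (u i : WithBot (ZMod 2)) := by
  have hiff : ((List.range k).map fun j => u (i + 1 + j)).take (k - 1) =
      List.replicate (k - 1) 1 ↔ ∀ j, 0 < j → j < k → u (i + j) = 1 := by
    rw [← List.map_take, List.take_range, List.eq_replicate_iff]
    simp only [List.length_map, List.length_range, List.mem_map, List.mem_range,
      forall_exists_index, and_imp]
    constructor
    · rintro ⟨-, h⟩ j h0 hj
      exact h _ (j - 1) (by omega) (by congr 1; omega)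
    · refine fun h => ⟨by omega, ?_⟩
      rintro _ j hj rfl
      rw [add_assoc]
      exact h _ (by omega) (by omega)
  have hget : ∀ j < k, ((List.range k).map fun j => u (i + 1 + j)).getD j 0 = u (i + 1 + j) := by
    intro j hj
    simp [List.getD, hj]
  rw [precedingLetter, if_neg hne, hget _ (by omega), hget _ (by omega),
    show i + 1 + (k - 1) = i + k by omega, show i + 1 + (k - 2) = i + (k - 1) by omega]
  split_ifs with h
  · rw [hu.eq_of_ones i (hiff.1 h)]
  · rw [hu.eq_of_not_ones i (mt hiff.2 h)]

theorem IsRunMinimalSequence.bwt_eq (hu : IsRunMinimalSequence k u) (hk : 2 ≤ k)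
    (h0 : List.replicate k 0 <+: (List.range (2 ^ k)).map u) :
    bwt (terminate (linearize k ((List.range (2 ^ k)).map u))) = bwtPattern k := by
  have hk2 := Nat.lt_two_pow_self (n := k)
  have hw0 : (List.range k).map (fun j => u (0 + j)) = List.replicate k 0 := by
    rw [← hu.take_rotate, List.rotate_zero, List.prefix_iff_eq_take.1 h0]
    simp
  have hz : ∀ j < k, u j = 0 := by
    intro j hj
    have := congrArg (fun l => l.getD j 1) hw0
    simpa [List.getD, hj, List.getElem?_replicate] using this
  have hlin : linearize k ((List.range (2 ^ k)).map u) = (List.range (2 ^ k + (k - 1))).map u := by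
    rw [linearize, List.range_add, List.map_append, List.map_map, ← List.map_take, List.take_range,
      min_eq_left (by omega)]
    congr 1
    exact List.map_congr_left fun j _ => by rw [Function.comp, add_comm, hu.periodic]
  have huniq : ∀ i, i < 2 ^ k →
      (List.range k).map (fun j => u (i + j)) = List.replicate k 0 → i = 0 := by
    intro i hi h
    obtain ⟨i₀, -, hun⟩ := hu.isDeBruijn.2 (List.replicate k 0) (by simp)
    rw [hun i ⟨hi, by rw [hu.take_rotate, h]⟩,
      hun 0 ⟨Nat.two_pow_pos k, by rw [hu.take_rotate, hw0]⟩]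
  -- By periodicity `0^k` follows this position, so the regular recurrence reads `0 + 0 + 1`. It is
  -- the last letter of the row starting with `0^{k-1} $`.
  have hlast : u (2 ^ k - 1) = 1 := by
    have h1 : ∀ j < k, u (2 ^ k - 1 + (j + 1)) = 0 := fun j hj => by
      rw [show 2 ^ k - 1 + (j + 1) = j + 2 ^ k by omega, hu.periodic, hz j hj]
    rw [hu.eq_of_not_ones, show u (2 ^ k - 1 + k) = 0 by
        simpa [show k - 1 + 1 = k by omega] using h1 (k - 1) (by omega),
      show u (2 ^ k - 1 + (k - 1)) = 0 by
        simpa [show k - 2 + 1 = k - 1 by omega] using h1 (k - 2) (by omega)]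
    · rfl
    · intro h
      have := h 1 (by omega) (by omega)
      rw [h1 0 (by omega)] at this
      exact zero_ne_one this
  rw [hlin, terminate_eq]
  rw [bwt_eq_of_rotations (k := k) (by simp; omega) (fun j => if j = k - 1 then 1 else 0)
    (precedingLetter k), map_precedingLetter_binaryWords hk]
  · obtain ⟨n, rfl⟩ : ∃ n, k = n + 1 := ⟨k - 1, by omega⟩
    rw [List.range_succ, List.map_append, bwtPattern]
    have : (List.range n).map (fun j => if j = n + 1 - 1 then (1 : WithBot (ZMod 2)) else 0) =
        List.replicate n 0 := by
      rw [List.eq_replicate_iff]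
      refine ⟨by simp, ?_⟩
      intro b hb
      obtain ⟨j, hj, rfl⟩ := List.mem_map.1 hb
      rw [if_neg]
      have := List.mem_range.1 hj
      omega
    rw [this]
    simp
  · intro j hj
    refine ⟨((List.range (2 ^ k + (k - 1 - j))).map u).map WithBot.some, ?_, ?_⟩
    · have : (List.range (2 ^ k + (k - 1))).map u =
          (List.range (2 ^ k + (k - 1 - j))).map u ++ List.replicate j 0 := by
        rw [show 2 ^ k + (k - 1) = 2 ^ k + (k - 1 - j) + j by omega, List.range_add,
          List.map_append, List.append_cancel_left_eq, List.eq_replicate_iff]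
        refine ⟨by simp, ?_⟩
        intro b hb
        simp only [List.map_map, List.mem_map, List.mem_range, Function.comp] at hb
        obtain ⟨i, hi, rfl⟩ := hb
        rw [show 2 ^ k + (k - 1 - j) + i = k - 1 - j + i + 2 ^ k by omega, hu.periodic]
        exact hz _ (by omega)
      rw [this, List.map_append, List.append_assoc, List.map_replicate]
      have := List.isRotated_append
        (l := List.replicate j (0 : WithBot (ZMod 2)) ++ [⊥])
        (l' := ((List.range (2 ^ k + (k - 1 - j))).map u).map WithBot.some)
      simpa using this
    · obtain ⟨m, hm⟩ : ∃ m, 2 ^ k + (k - 1 - j) = m + 1 := ⟨2 ^ k + (k - 1 - j) - 1, by omega⟩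
      have hmu : ((u m : ZMod 2) : WithBot (ZMod 2)) = if j = k - 1 then 1 else 0 := by
        split_ifs with h
        · rw [show m = 2 ^ k - 1 by omega, hlast]; rfl
        · rw [show m = k - 1 - j - 1 + 2 ^ k by omega, hu.periodic, hz _ (by omega)]; rfl
      rw [hm, List.range_succ, ← hmu]
      simp [List.getLast?_append, List.getLast?_cons]
  · intro v hv
    obtain ⟨i, ⟨hi, hiv⟩, -⟩ := hu.isDeBruijn.2 v hv
    rw [hu.take_rotate] at hiv
    subst hiv
    set v := (List.range k).map fun j => u (i + j)
    set Y := (List.range (2 ^ k - 1 - i)).map fun j => u (i + k + j)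
    have hsplit : (List.range (2 ^ k + (k - 1))).map u = (List.range i).map u ++ v ++ Y := by
      rw [show 2 ^ k + (k - 1) = i + k + (2 ^ k - 1 - i) by omega, List.range_add, List.range_add]
      simp [v, Y, Function.comp_def, add_assoc]
    refine ⟨Y.map WithBot.some ++ [⊥] ++ ((List.range i).map u).map WithBot.some, ?_, ?_⟩
    · rw [hsplit]
      have := List.isRotated_append
        (l := v.map WithBot.some ++ Y.map WithBot.some ++ [⊥])
        (l' := ((List.range i).map u).map WithBot.some)
      simpa using this
    -- Position 0 carries `0^k` and its row ends in `$`; at any other position the row ends in the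
    -- preceding letter of `u`.
    · rcases i with _ | i
      · have : v = List.replicate k 0 := hw0
        rw [this]
        simp [precedingLetter, List.getLast?_append]
      · rw [hu.precedingLetter_window hk i fun h => Nat.succ_ne_zero i (huniq _ hi h),
          List.range_succ]
        simp only [List.map_append, List.map_cons, List.map_nil, ← List.append_assoc]
        exact List.getLast?_concat

end Windows

theorem mainTheorem3 (k : ℕ) (hk : 2 ≤ k) (hT : IsPrimitiveBinary (lfsrTrinomial k))
    (M : Cycle (ZMod 2)) (hM : M ∈ runMinimalWords k) :
    (∃! U : List (ZMod 2), (U : Cycle (ZMod 2)) = M ∧ List.replicate k 0 <+: U) ∧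
    ∀ U : List (ZMod 2), (U : Cycle (ZMod 2)) = M → List.replicate k 0 <+: U →
      IsDeBruijn k U ∧
      bwt (terminate (linearize k U)) = bwtPattern k ∧
      numRuns (bwt (terminate (linearize k U))) = 2 ^ (k - 1) + 4 := by
  constructor
  · obtain ⟨L, rfl⟩ : ∃ L : List (ZMod 2), (L : Cycle (ZMod 2)) = M := Quotient.exists_rep M
    obtain ⟨u, hu, hLu⟩ := exists_isRunMinimalSequence hk hT hM rfl
    have hL : IsDeBruijn k L := hLu ▸ hu.isDeBruijn
    obtain ⟨i, ⟨-, hi⟩, -⟩ := hL.2 (List.replicate k 0) (by simp)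
    have hrot : ((L.rotate i : List (ZMod 2)) : Cycle (ZMod 2)) = L :=
      Cycle.coe_eq_coe.2 (List.IsRotated.symm ⟨i, rfl⟩)
    refine ⟨L.rotate i, ⟨hrot, hi ▸ List.take_prefix _ _⟩, ?_⟩
    rintro V ⟨hV, hV0⟩
    -- The rotated word is itself de Bruijn, so `0^k` occurs in it only at position 0, which forces
    -- any further rotation starting with `0^k` to be trivial.
    obtain ⟨u', hu', hLu'⟩ := exists_isRunMinimalSequence hk hT hM hrot
    have hD : IsDeBruijn k (L.rotate i) := hLu' ▸ hu'.isDeBruijn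
    obtain ⟨r, rfl⟩ : L.rotate i ~r V := Cycle.coe_eq_coe.1 (hrot.trans hV.symm)
    obtain ⟨i₀, -, hun⟩ := hD.2 (List.replicate k 0) (by simp)
    have h1 := hun 0 ⟨Nat.two_pow_pos k, by simpa using hi⟩
    have h2 := hun (r % 2 ^ k) ⟨Nat.mod_lt _ (Nat.two_pow_pos k), by
      have := List.prefix_iff_eq_take.1 hV0
      rw [List.length_replicate] at this
      rw [← hD.1, List.rotate_mod, ← this]⟩
    rw [← List.rotate_mod, hD.1, h2, ← h1, List.rotate_zero]
  · intro U hU h0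
    obtain ⟨u, hu, rfl⟩ := exists_isRunMinimalSequence hk hT hM hU
    have hb := hu.bwt_eq hk h0
    exact ⟨hu.isDeBruijn, hb, hb ▸ numRuns_bwtPattern hk⟩
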